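/- **Conventions.** A toy bit has the ontic states $1,2,3,4$. A diagram with $n$ inputs and $m$ outputs denotes a relation $\{1,2,3,4\}^n\to\{1,2,3,4\}^m$; juxtaposition denotes the Cartesian product of relations and connecting wires denotes relational composition, so a diagram with no inputs and $m$ outputs (a *state diagram*) denotes a subset of $\{1,2,3,4\}^m$, its *state*. Let $\delta$ be the relation from one toy bit to two given by $$1\sim\{(1,1),(2,2)\},\quad 2\sim\{(1,2),(2,1)\},\quad 3\sim\{(3,3),(4,4)\},\quad 4\sim\{(3,4),(4,3)\},$$ and let $s_{00}=\{1,3\}$, $s_{01}=\{1,4\}$, $s_{10}=\{2,3\}$, $s_{11}=\{2,4\}$. The green spider with phase label $xy$ ($x,y\in\{0,1\}$) merges all its inputs into one wire by the converse of $\delta$ (no inputs: the state $s_{00}$), joins the result with $s_{xy}$ by the converse of $\delta$, and splits the result into its outputs by $\delta$ (no outputs: the converse of $s_{00}$). The node $H$ denotes the permutation $(2\,3)$ of the ontic states. A red spider is a green spider with the same label and with $H$ on every input and every output. Spiders with one input and one output are called phase shifts. The *graph state diagram* of a finite simple graph $G$ has a green node (label $00$) with one output for each vertex, and for each edge a copy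 of $H$ connected to the green nodes of its two end points. A *GS-LO diagram* on $n$ toy bits consists of the graph state diagram of a graph on $n$ vertices together with a reversible single-toy-bit operator (a chain of phase shifts and nodes $H$), called a *vertex operator*, on each output. It is an *rGS-LO diagram* if (i) each vertex operator is either a green phase shift with label $ab$, $a,b\in\{0,1\}$, or a green phase shift with label $a\bar a$ followed (towards the output) by a red phase shift with label $01$, where $a\in\{0,1\}$ and $\bar a=1-a$; and (ii) no two adjacent vertices both have a red node in their vertex operators. A pair of rGS-LO diagrams $D_1,D_2$ on the same $n$ toy bits is *simplified* if there are no toy bits $p,q$ such that $p$ has a red node in its vertex operator in $D_1$ but not in $D_2$, $q$ has a red node in its vertex operator in $D_2$ but not in $D_1$, and $p$ and $q$ are adjacent in at least one of the two diagrams. **Lemma.** Let $D_1,D_2$ be a simplified pair of rGS-LO diagrams on $n$ toy bits. Suppose there is a toy bit $p$ which has a red node in its vertex operator in one of the two diagrams but not in the other. Then $D_1$ and $D_2$ are not equal: they denote different states, $[\![D_1]\!]\neq[\![D_2]\!]$. -/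

import Mathlib

namespace SpekkensToy

/-- The four ontic states `1, 2, 3, 4` of a toy bit. -/
inductive Ontic where
  | one
  | two
  | three
  | four
  deriving DecidableEq

instance : Fintype Ontic where
  elems := {Ontic.one, Ontic.two, Ontic.three, Ontic.four}
  complete x := by cases x <;> decide

open Ontic

/-- The green node with one input and two outputs: the pairs related to a given input. -/
def split : Ontic → Set (Ontic × Ontic)
  | one => {(one, one), (two, two)}
  | two => {(one, two), (two, one)}
  | three => {(three, three), (four, four)}
  | four => {(three, four), (four, three)}

/-- The state denoted by a green node with one output and phase label `xy`
(`false` is the bit `0`, `true` is the bit `1`). -/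
def greenState : Bool → Bool → Set Ontic
  | false, false => {one, three}
  | false, true => {one, four}
  | true, false => {two, three}
  | true, true => {two, four}

/-- The reversible single-toy-bit operation that exchanges `2` and `3`. -/
def had : Ontic → Ontic
  | one => one
  | two => three
  | three => two
  | four => four

/-- `FanOut a outs`: the input `a` is related to the list of outputs `outs` by the iterated green
node `split`. For an empty list of outputs this is the effect `1 ∼ •, 3 ∼ •`, the converse of the
state with phase label `00`. The converse relation merges a list of inputs into one wire. -/
def FanOut : Ontic → List Ontic → Prop
  | a, [] => a ∈ greenState false false
  | a, [b] => a = b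
  | a, b :: c :: l => ∃ d, (b, d) ∈ split a ∧ FanOut d (c :: l)

/-- The relation denoted by the green spider with phase label `xy` and any numbers of inputs and
outputs: merge the inputs into one wire, join that wire with the state `xy`, split the result into
the outputs. -/
def GreenSpider (x y : Bool) (ins outs : List Ontic) : Prop :=
  ∃ a s b, FanOut a ins ∧ s ∈ greenState x y ∧ (a, s) ∈ split b ∧ FanOut b outs

/-- The relation denoted by the red spider: the green spider with a copy of `had` on every input
and every output. -/
def RedSpider (x y : Bool) (ins outs : List Ontic) : Prop :=
  GreenSpider x y (ins.map had) (outs.map had)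

/-- The nodes from which reversible single-toy-bit operators are built: green and red phase shifts
with label `xy`, and the node `had`. -/
inductive LocalNode where
  | green (x y : Bool)
  | red (x y : Bool)
  | hadNode

/-- The relation from input to output denoted by a single node with one input and one output. -/
def LocalNode.Rel : LocalNode → Ontic → Ontic → Prop
  | .green x y, a, b => GreenSpider x y [a] [b]
  | .red x y, a, b => RedSpider x y [a] [b]
  | .hadNode, a, b => had a = b

/-- A single-toy-bit operator: a chain of nodes, listed from the input to the output. -/
abbrev LocalOp := List LocalNode

/-- The relation denoted by a chain of nodes: the relational composite. The empty chain is a plain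
wire. -/
def LocalOp.Rel : LocalOp → Ontic → Ontic → Prop
  | [], a, c => a = c
  | N :: l, a, c => ∃ b, N.Rel a b ∧ LocalOp.Rel l b c

/-- The operator contains a red node. -/
def LocalOp.HasRed (l : LocalOp) : Prop := ∃ x y, LocalNode.red x y ∈ l

/-- The set `R` of vertex operators allowed in reduced diagrams: the four green phase shifts, and
the two operators consisting of a green phase shift with label `01` or `10` followed by a red
phase shift with label `01`. -/
def reducedOps : Set LocalOp :=
  {l | (∃ a b, l = [.green a b]) ∨ (∃ a, l = [.green a (!a), .red false true])}

open Classical in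
/-- The state denoted by the graph state diagram of a graph `G`, as a set of output values. The
diagram has, for each vertex `v`, a green node with one output and one wire for each edge at `v`,
and, for each edge, a copy of `had` joining the two wires that come from its end points. The value
on the wire that leaves `v` towards its neighbour `k` is `w v k`; composing relations means that
the values on all internal wires are quantified existentially. -/
def graphState {n : ℕ} (G : SimpleGraph (Fin n)) : Set (Fin n → Ontic) :=
  {out | ∃ w : Fin n → Fin n → Ontic,
    (∀ v, GreenSpider false false []
      (out v :: ((List.finRange n).filter (fun k => G.Adj v k)).map (w v))) ∧
    (∀ v k, G.Adj v k → had (w v k) = w k v)}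

/-- A GS-LO diagram on `n` toy bits: a graph state with a reversible single-toy-bit operator (the
*vertex operator*) on each output. -/
structure GSLODiagram (n : ℕ) where
  graph : SimpleGraph (Fin n)
  vertexOp : Fin n → LocalOp

namespace GSLODiagram

variable {n : ℕ}

/-- The state (a set of `n`-tuples of ontic states) denoted by a GS-LO diagram. -/
def state (D : GSLODiagram n) : Set (Fin n → Ontic) :=
  {x | ∃ out ∈ graphState D.graph, ∀ v, LocalOp.Rel (D.vertexOp v) (out v) (x v)}

/-- The toy bit `p` has a red node in its vertex operator. -/
def RedAt (D : GSLODiagram n) (p : Fin n) : Prop := LocalOp.HasRed (D.vertexOp p)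

/-- Reduced GS-LO form. -/
def IsReduced (D : GSLODiagram n) : Prop :=
  (∀ p, D.vertexOp p ∈ reducedOps) ∧
  (∀ p q, D.graph.Adj p q → ¬ (D.RedAt p ∧ D.RedAt q))

/-- A simplified pair of rGS-LO diagrams. -/
def IsSimplifiedPair (D₁ D₂ : GSLODiagram n) : Prop :=
  D₁.IsReduced ∧ D₂.IsReduced ∧
  ¬ ∃ p q, (D₁.RedAt p ∧ ¬ D₂.RedAt p) ∧ (D₂.RedAt q ∧ ¬ D₁.RedAt q) ∧
    (D₁.graph.Adj p q ∨ D₂.graph.Adj p q)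

end GSLODiagram

end SpekkensToy

namespace SpekkensToy

open Ontic

/-! Write an ontic state as a pair (z, x) over 𝔽₂: green spiders copy z and add x, and `had` swaps
the two. A graph state is then the linear system saying that x at each vertex is the sum of z over
its neighbours. A vertex operator without red preserves z; one with red outputs x plus a constant as
its new z. Let p be red in D₁ only. In D₁, z at p is fixed by z at its neighbours. By simplification
p and these neighbours are all non-red in D₂, where such z are free, so the states differ. -/

/-- The coordinate of an ontic state that the green node copies. -/
def zBit : Ontic → ZMod 2
  | one => 0
  | two => 0
  | three => 1
  | four => 1

/-- The coordinate of an ontic state that the green node adds up. -/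
def xBit : Ontic → ZMod 2
  | one => 0
  | two => 1
  | three => 0
  | four => 1

/-- The ontic state with given coordinates. -/
def ofBits (z x : ZMod 2) : Ontic :=
  if z = 0 then (if x = 0 then one else two) else (if x = 0 then three else four)

@[simp] theorem zBit_ofBits : ∀ z x, zBit (ofBits z x) = z := by decide

@[simp] theorem xBit_ofBits : ∀ z x, xBit (ofBits z x) = x := by decide

@[simp] theorem zBit_had (a : Ontic) : zBit (had a) = xBit a := by cases a <;> rfl

@[simp] theorem xBit_had (a : Ontic) : xBit (had a) = zBit a := by cases a <;> rfl

theorem eq_iff_bits : ∀ a b : Ontic, a = b ↔ zBit a = zBit b ∧ xBit a = xBit b := by decide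

theorem mem_split_iff (a b c : Ontic) :
    (b, c) ∈ split a ↔ zBit b = zBit a ∧ zBit c = zBit a ∧ xBit b + xBit c = xBit a := by
  cases a <;> cases b <;> cases c <;> simp [split] <;> decide

/-- The bit of a toy bit state with phase label `xy`, as a function of its other coordinate. -/
def phase (x y : Bool) (z : ZMod 2) : ZMod 2 :=
  (if x then 1 else 0) + (if x = y then 0 else z)

theorem mem_greenState_iff (x y : Bool) (a : Ontic) :
    a ∈ greenState x y ↔ xBit a = phase x y (zBit a) := by
  cases x <;> cases y <;> cases a <;> simp [greenState] <;> decide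

theorem fanOut_iff (a : Ontic) (l : List Ontic) :
    FanOut a l ↔ (∀ b ∈ l, zBit b = zBit a) ∧ (l.map xBit).sum = xBit a := by
  induction l generalizing a with
  | nil => simp [FanOut, mem_greenState_iff, phase, eq_comm]
  | cons b l ih =>
    cases l with
    | nil => simp [FanOut, eq_iff_bits a b, @eq_comm _ (zBit a), @eq_comm _ (xBit a)]
    | cons c l =>
      simp only [FanOut, mem_split_iff, ih]
      constructor
      · rintro ⟨d, ⟨h1, h2, h3⟩, h4, h5⟩
        refine ⟨?_, ?_⟩
        · intro e he
          rcases List.mem_cons.1 he with rfl | he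
          · exact h1
          · rw [h4 e he, h2]
        · rw [List.map_cons, List.sum_cons, h5, h3]
      · rintro ⟨h1, h2⟩
        refine ⟨ofBits (zBit a) ((c :: l).map xBit).sum, ⟨h1 b (by simp), by simp, ?_⟩, ?_, ?_⟩
        · rw [xBit_ofBits, ← h2, List.map_cons (a := b), List.sum_cons]
        · intro e he
          rw [zBit_ofBits]
          exact h1 e (List.mem_cons_of_mem _ he)
        · rw [xBit_ofBits]

theorem greenSpider_iff (x y : Bool) (ins outs : List Ontic) :
    GreenSpider x y ins outs ↔ ∃ z, (∀ b ∈ ins, zBit b = z) ∧ (∀ b ∈ outs, zBit b = z) ∧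
      (ins.map xBit).sum + phase x y z = (outs.map xBit).sum := by
  simp only [GreenSpider, fanOut_iff, mem_greenState_iff, mem_split_iff]
  constructor
  · rintro ⟨a, s, b, ⟨h1, h2⟩, h3, ⟨h4, h5, h6⟩, h7, h8⟩
    refine ⟨zBit b, fun c hc => (h1 c hc).trans h4, h7, ?_⟩
    rw [h2, h8, ← h6, h3, h5]
  · rintro ⟨z, h1, h2, h3⟩
    exact ⟨ofBits z (ins.map xBit).sum, ofBits z (phase x y z), ofBits z (outs.map xBit).sum,
      by simpa using h1, by simp, by simpa using h3, by simpa using h2⟩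

theorem rel_green_iff (x y : Bool) (a b : Ontic) :
    (LocalNode.green x y).Rel a b ↔ zBit b = zBit a ∧ xBit b = xBit a + phase x y (zBit a) := by
  simp [LocalNode.Rel, greenSpider_iff, eq_comm]

theorem rel_red_iff (x y : Bool) (a b : Ontic) :
    (LocalNode.red x y).Rel a b ↔ xBit b = xBit a ∧ zBit b = zBit a + phase x y (xBit a) := by
  simp [LocalNode.Rel, RedSpider, greenSpider_iff, eq_comm]

theorem rel_reducedOps_of_not_hasRed {l : LocalOp} (hl : l ∈ reducedOps) (h : ¬ l.HasRed)
    {a b : Ontic} (hab : l.Rel a b) : zBit b = zBit a := by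
  rcases hl with ⟨x, y, rfl⟩ | ⟨x, rfl⟩
  · obtain ⟨c, hc, rfl⟩ := hab
    exact ((rel_green_iff _ _ _ _).1 hc).1
  · exact absurd ⟨false, true, by simp⟩ h

/-- The green shift with label a, ā sends x to x + z + a, and the red shift 01 adds this new x to z.
The two copies of z cancel, leaving x + a. -/
theorem rel_reducedOps_of_hasRed {l : LocalOp} (hl : l ∈ reducedOps) (h : l.HasRed) :
    ∃ t, ∀ a b, l.Rel a b → zBit b = xBit a + t := by
  rcases hl with ⟨x, y, rfl⟩ | ⟨x, rfl⟩
  · simp [LocalOp.HasRed] at h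
  · refine ⟨if x then 1 else 0, ?_⟩
    rintro a b ⟨c, hc, d, hd, rfl⟩
    rw [rel_green_iff] at hc
    rw [rel_red_iff] at hd
    obtain ⟨hcz, hcx⟩ := hc
    rw [hd.2, hcz, hcx]
    clear hd hcx h
    generalize zBit a = z, xBit a = u
    revert x z u
    decide

theorem exists_rel_reducedOps {l : LocalOp} (hl : l ∈ reducedOps) (a : Ontic) :
    ∃ b, l.Rel a b := by
  rcases hl with ⟨x, y, rfl⟩ | ⟨x, rfl⟩
  · exact ⟨ofBits (zBit a) (xBit a + phase x y (zBit a)), _,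
      (rel_green_iff _ _ _ _).2 ⟨zBit_ofBits _ _, xBit_ofBits _ _⟩, rfl⟩
  · exact ⟨_, ofBits (zBit a) (xBit a + phase x (!x) (zBit a)),
      (rel_green_iff _ _ _ _).2 ⟨zBit_ofBits _ _, xBit_ofBits _ _⟩, ofBits _ _,
      (rel_red_iff _ _ _ _).2 ⟨xBit_ofBits _ _, zBit_ofBits _ _⟩, rfl⟩

-- Each edge's `had` turns the z copied at one end into the x summand at the other, which eliminates
-- the internal wires.
open Classical in
theorem mem_graphState_iff {n : ℕ} (G : SimpleGraph (Fin n)) (out : Fin n → Ontic) :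
    out ∈ graphState G ↔ ∀ v, xBit (out v) =
      (((List.finRange n).filter (fun k => G.Adj v k)).map (fun k => zBit (out k))).sum := by
  simp only [graphState, Set.mem_ofPred_eq, greenSpider_iff]
  constructor
  · rintro ⟨w, h1, h2⟩ v
    have hz : ∀ v k, G.Adj v k → zBit (w v k) = zBit (out v) := by
      intro v k hvk
      obtain ⟨z, -, hz, -⟩ := h1 v
      rw [hz (w v k), hz (out v)]
      · simp
      · exact List.mem_cons_of_mem _ (List.mem_map_of_mem (by simpa using hvk))
    obtain ⟨z, -, -, hx⟩ := h1 v
    have hx' : xBit (out v) = (((List.finRange n).filter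
        (fun k => G.Adj v k)).map (fun k => xBit (w v k))).sum := by
      simp only [phase, List.map_nil, List.sum_nil, List.map_cons, List.sum_cons, List.map_map,
        Bool.false_eq_true, if_false, if_true, add_zero] at hx
      exact CharTwo.add_eq_zero.1 hx.symm
    rw [hx']
    refine congrArg List.sum (List.map_congr_left fun k hk => ?_)
    have hvk : G.Adj v k := by simpa using hk
    rw [← hz k v hvk.symm, ← h2 v k hvk, zBit_had]
  · intro h
    -- The wire from v to k carries v's own z and, as x, the z of k; `had` exchanges these roles.
    refine ⟨fun v k => ofBits (zBit (out v)) (zBit (out k)), fun v => ⟨zBit (out v), ?_, ?_, ?_⟩, ?_⟩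
    · simp
    · intro b hb
      rcases List.mem_cons.1 hb with rfl | hb
      · rfl
      · obtain ⟨k, -, rfl⟩ := List.mem_map.1 hb
        exact zBit_ofBits _ _
    · simp only [phase, List.map_nil, List.sum_nil, List.map_cons, List.sum_cons, List.map_map,
        Bool.false_eq_true, if_false, if_true, add_zero, Function.comp_def, xBit_ofBits]
      exact (CharTwo.add_eq_zero.2 (h v)).symm
    · intro v k _
      simp [eq_iff_bits]

namespace GSLODiagram

variable {n : ℕ}

/-- At a red vertex of a reduced diagram, the copied coordinate is determined up to a constant by
the copied coordinates at the neighbours. -/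
theorem IsReduced.zBit_eq_of_redAt {D : GSLODiagram n} (hD : D.IsReduced) {p : Fin n}
    (hp : D.RedAt p) {x y : Fin n → Ontic} (hx : x ∈ D.state) (hy : y ∈ D.state)
    (hxy : ∀ k, D.graph.Adj p k → zBit (x k) = zBit (y k)) : zBit (x p) = zBit (y p) := by
  obtain ⟨t, ht⟩ := rel_reducedOps_of_hasRed (hD.1 p) hp
  obtain ⟨u, hu, hux⟩ := hx
  obtain ⟨v, hv, hvy⟩ := hy
  rw [ht _ _ (hux p), ht _ _ (hvy p), (mem_graphState_iff _ _).1 hu p,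
    (mem_graphState_iff _ _).1 hv p]
  congr 2
  refine List.map_congr_left fun k hk => ?_
  have hpk : D.graph.Adj p k := by simpa using hk
  -- Adjacent vertices are never both red, so the operator at k preserves z.
  have hk : ¬ D.RedAt k := fun hk => hD.2 p k hpk ⟨hp, hk⟩
  rw [← rel_reducedOps_of_not_hasRed (hD.1 k) hk (hux k), hxy k hpk,
    rel_reducedOps_of_not_hasRed (hD.1 k) hk (hvy k)]

/-- The copied coordinates at the vertices without red nodes are free. -/
theorem IsReduced.exists_mem_state {D : GSLODiagram n} (hD : D.IsReduced) (z : Fin n → ZMod 2) :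
    ∃ x ∈ D.state, ∀ k, ¬ D.RedAt k → zBit (x k) = z k := by
  classical
  -- Any choice of z extends to the graph state by solving for x.
  let out : Fin n → Ontic := fun v =>
    ofBits (z v) (((List.finRange n).filter (fun k => D.graph.Adj v k)).map z).sum
  choose x hx using fun v => exists_rel_reducedOps (hD.1 v) (out v)
  refine ⟨x, ⟨out, (mem_graphState_iff _ _).2 fun v => ?_, hx⟩, fun k hk => ?_⟩
  · simp only [out, xBit_ofBits, zBit_ofBits]
  · rw [rel_reducedOps_of_not_hasRed (hD.1 k) hk (hx k)]
    exact zBit_ofBits _ _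

theorem IsSimplifiedPair.symm {D₁ D₂ : GSLODiagram n} (h : IsSimplifiedPair D₁ D₂) :
    IsSimplifiedPair D₂ D₁ :=
  ⟨h.2.1, h.1, fun ⟨p, q, hp, hq, hpq⟩ =>
    h.2.2 ⟨q, p, hq, hp, hpq.symm.imp SimpleGraph.Adj.symm SimpleGraph.Adj.symm⟩⟩

theorem IsSimplifiedPair.state_ne {D₁ D₂ : GSLODiagram n} (h : IsSimplifiedPair D₁ D₂) {p : Fin n}
    (hp₁ : D₁.RedAt p) (hp₂ : ¬ D₂.RedAt p) : D₁.state ≠ D₂.state := by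
  intro heq
  obtain ⟨x, hx, hxz⟩ := h.2.1.exists_mem_state 0
  -- Among the vertices non-red in D₂, the z of x and y differ only at p.
  obtain ⟨y, hy, hyz⟩ := h.2.1.exists_mem_state (Pi.single p 1)
  have hxy := h.1.zBit_eq_of_redAt hp₁ (heq ▸ hx) (heq ▸ hy) fun k hpk => by
    have hk₁ : ¬ D₁.RedAt k := fun hk => h.1.2 p k hpk ⟨hp₁, hk⟩
    have hk₂ : ¬ D₂.RedAt k := fun hk => h.2.2 ⟨p, k, ⟨hp₁, hp₂⟩, ⟨hk, hk₁⟩, Or.inl hpk⟩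
    rw [hxz k hk₂, hyz k hk₂, Pi.single_eq_of_ne hpk.ne', Pi.zero_apply]
  rw [hxz p hp₂, hyz p hp₂, Pi.single_eq_same, Pi.zero_apply] at hxy
  exact zero_ne_one hxy

end GSLODiagram

end SpekkensToy

theorem mainTheorem10 (n : ℕ) (D₁ D₂ : SpekkensToy.GSLODiagram n)
    (hsimp : SpekkensToy.GSLODiagram.IsSimplifiedPair D₁ D₂)
    (hunpaired : ∃ p : Fin n, (D₁.RedAt p ∧ ¬ D₂.RedAt p) ∨ (D₂.RedAt p ∧ ¬ D₁.RedAt p)) :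
    D₁.state ≠ D₂.state := by
  obtain ⟨p, ⟨hp₁, hp₂⟩ | ⟨hp₂, hp₁⟩⟩ := hunpaired
  · exact hsimp.state_ne hp₁ hp₂
  · exact (hsimp.symm.state_ne hp₂ hp₁).symm
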